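/- **Dual Cauchy identity.** For a partition $\lambda$ (the empty partition included) let $\lambda'$ be its conjugate, and let $s_\lambda$ be the Schur function $$s_\lambda(x)=\sum_{T\in\mathrm{SSYT}(\lambda)}x^T,\qquad x^T=\prod_{i\ge 1}x_i^{\#\{\text{cells of }T\text{ with entry }i\}},$$ where $\mathrm{SSYT}(\lambda)$ is the set of semistandard Young tableaux of shape $\lambda$ with positive integer entries; $s_\lambda(x_1,\dots,x_n)$ is the same sum over the tableaux with all entries at most $n$. Let $R$ be a commutative ring of coefficients. 1. In the ring of formal power series over $R$ in the infinitely many variables $x_1,x_2,\dots,y_1,y_2,\dots$ the sum and the product below converge coefficientwise (with $R$ discrete), and $$\sum_{\lambda}s_\lambda(x)\,s_{\lambda'}(y)=\prod_{i,j\ge1}(1+x_iy_j),$$ the sum being over all partitions $\lambda$. 2. For all integers $n,m\ge 0$, in the polynomial ring $R[x_1,\dots,x_n,y_1,\dots,y_m]$, $$\sum_{\lambda}s_\lambda(x_1,\dots,x_n)\,s_{\lambda'}(y_1,\dots,y_m)=\prod_{i=1}^{n}\prod_{j=1}^{m}(1+x_iy_j),$$ the sum being over all partitions $\lambda$, with only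 finitely many nonzero terms. -/

import Mathlib

open scoped MvPowerSeries.WithPiTopology

namespace SemistandardYoungTableau

/-- The content of a tableau `T`: the finitely supported function sending `i` to the number of
cells of `T` with entry `i`. Entries of Mathlib's tableaux start from `0`, so that the
entry `i` here is the entry `i + 1` of a classical tableau filled with positive integers. -/
noncomputable def content {μ : YoungDiagram} (T : SemistandardYoungTableau μ) : ℕ →₀ ℕ :=
  ∑ c ∈ μ.cells, Finsupp.single (T c.1 c.2) 1

theorem content_apply {μ : YoungDiagram} (T : SemistandardYoungTableau μ) (i : ℕ) :
    T.content i = (μ.cells.filter fun c => T c.1 c.2 = i).card := by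
  simp [content, Finsupp.finsetSum_apply, Finsupp.single_apply, Finset.sum_boole]

/-- There are finitely many tableaux of a given shape with entries below `n`. -/
instance finite_bounded (μ : YoungDiagram) (n : ℕ) :
    Finite {T : SemistandardYoungTableau μ // ∀ c ∈ μ.cells, T c.1 c.2 < n} := by
  let f : {T : SemistandardYoungTableau μ // ∀ c ∈ μ.cells, T c.1 c.2 < n} →
      (μ.cells → Fin n) := fun T c => ⟨T.1 c.1.1 c.1.2, T.2 c.1 c.2⟩
  refine Finite.of_injective f fun T T' h => Subtype.ext ?_
  ext i j
  by_cases hc : (i, j) ∈ μ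
  · have := congrFun h ⟨(i, j), (YoungDiagram.mem_cells (i, j)).2 hc⟩
    simpa [f] using this
  · rw [T.1.zeros hc, T'.1.zeros hc]

noncomputable instance fintypeBounded (μ : YoungDiagram) (n : ℕ) :
    Fintype {T : SemistandardYoungTableau μ // ∀ c ∈ μ.cells, T c.1 c.2 < n} :=
  Fintype.ofFinite _

/-- There are finitely many tableaux of a given shape and content. -/
instance finite_content_eq (μ : YoungDiagram) (d : ℕ →₀ ℕ) :
    Finite {T : SemistandardYoungTableau μ // T.content = d} := by
  have key : ∀ T : SemistandardYoungTableau μ, T.content = d →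
      ∀ c ∈ μ.cells, T c.1 c.2 < d.support.sup id + 1 := by
    rintro T rfl c hc
    refine Nat.lt_succ_of_le (Finset.le_sup (f := id) ?_)
    rw [Finsupp.mem_support_iff, content_apply]
    exact Finset.card_ne_zero_of_mem (Finset.mem_filter.2 ⟨hc, rfl⟩)
  exact Finite.of_injective
    (fun T => (⟨T.1, key T.1 T.2⟩ : {T : SemistandardYoungTableau μ //
      ∀ c ∈ μ.cells, T c.1 c.2 < d.support.sup id + 1}))
    fun T T' h => Subtype.ext (congrArg (fun S => S.1) h)

end SemistandardYoungTableau

/-- The Schur polynomial `s_μ(x_0, …, x_{n-1})`: the sum of the content monomials of the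
semistandard tableaux of shape `μ` whose entries are among the `n` smallest letters. -/
noncomputable def schurPolynomial (R : Type*) [CommRing R] (μ : YoungDiagram) (n : ℕ) :
    MvPolynomial (Fin n) R :=
  ∑ T : {T : SemistandardYoungTableau μ // ∀ c ∈ μ.cells, T c.1 c.2 < n},
    ∏ i : Fin n, MvPolynomial.X i ^ T.1.content i

/-- The Schur function `s_μ(x_0, x_1, …)` as a formal power series in infinitely many variables:
the sum of the content monomials of all semistandard tableaux of shape `μ`, that is, the
coefficient of the monomial `x ^ d` is the number of such tableaux with content `d`. -/
noncomputable def schurFunction (R : Type*) [CommRing R] (μ : YoungDiagram) :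
    MvPowerSeries ℕ R :=
  fun d => (Nat.card {T : SemistandardYoungTableau μ // T.content = d} : R)

/-! Deleting the largest letter from a tableau removes a horizontal strip, so Schur polynomials are
built one variable at a time (`schurEval_succ`); for conjugate shapes the strips are vertical. The
heart is the commutation relation `sum_stripWeight_mul_stripWeight`: adding a horizontal strip
weighted by `x` and then removing a vertical strip weighted by `y` amounts to doing so in the
opposite order, times `1 + x * y`. Both sides factor over the rows of the intermediate diagram, and
the row factors agree up to boundary terms that telescope (`sum_row_mul_gapWeight`).

Moving one `x`-strip past all `y`-strips gives the dual Pieri rule `sum_stripWeight_mul_schurEval`;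
doing so for each `x` gives the finite identity `sum_schurEval_mul_schurEval` in any commutative
ring, hence for polynomials. A coefficient of a power series involves only finitely many variables,
so the infinite identity follows from the finite one, coefficient by coefficient. -/

/-! ### Strips, boxes and row lengths of Young diagrams -/

namespace YoungDiagram

/-- The skew shape `μ / ν` is a horizontal strip: it has at most one cell in every column. -/
def IsHorizontalStrip (ν μ : YoungDiagram) : Prop :=
  ν ≤ μ ∧ ∀ i j, (i + 1, j) ∈ μ → (i, j) ∈ ν

theorem le_iff_rowLen {ν μ : YoungDiagram} : ν ≤ μ ↔ ∀ i, ν.rowLen i ≤ μ.rowLen i := by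
  constructor
  · intro h i
    by_contra! hi
    have h1 : (i, μ.rowLen i) ∈ ν := mem_iff_lt_rowLen.2 hi
    exact lt_irrefl _ (mem_iff_lt_rowLen.1 (h h1))
  · rintro h ⟨i, j⟩ hc
    exact mem_iff_lt_rowLen.2 ((mem_iff_lt_rowLen.1 hc).trans_le (h i))

theorem ext_rowLen {ν μ : YoungDiagram} (h : ∀ i, ν.rowLen i = μ.rowLen i) : ν = μ :=
  le_antisymm (le_iff_rowLen.2 fun i => (h i).le) (le_iff_rowLen.2 fun i => (h i).ge)

/-- With its vertical counterpart below, this turns strip conditions into inequalities on single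
rows, which is what lets sums over diagrams factor. -/
theorem isHorizontalStrip_iff_rowLen {ν μ : YoungDiagram} : IsHorizontalStrip ν μ ↔
    ∀ i, ν.rowLen i ≤ μ.rowLen i ∧ μ.rowLen (i + 1) ≤ ν.rowLen i := by
  rw [IsHorizontalStrip, le_iff_rowLen, forall_and]
  refine and_congr_right fun _ => forall_congr' fun i => ?_
  simp only [mem_iff_lt_rowLen]
  constructor
  · intro h
    by_contra! hi
    exact lt_irrefl _ (h _ hi)
  · exact fun h j hj => hj.trans_le h

theorem isHorizontalStrip_transpose_iff_rowLen {ν μ : YoungDiagram} :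
    IsHorizontalStrip ν.transpose μ.transpose ↔
      ∀ i, ν.rowLen i ≤ μ.rowLen i ∧ μ.rowLen i ≤ ν.rowLen i + 1 := by
  rw [IsHorizontalStrip, transpose_le_iff, le_iff_rowLen, forall_and]
  refine and_congr_right fun _ => ?_
  have hmem : ∀ (κ : YoungDiagram) i j, (i, j) ∈ κ.transpose ↔ i < κ.rowLen j := fun κ i j => by
    rw [mem_transpose, Prod.swap_prod_mk, mem_iff_lt_rowLen]
  simp only [hmem]
  constructor
  · intro h i
    by_contra! hi
    have := h (ν.rowLen i) i (by omega)
    omega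
  · intro h j i hj
    have := h i
    omega

theorem card_eq_sum_rowLen (μ : YoungDiagram) {k : ℕ} (hk : μ.rowLen k = 0) :
    μ.card = ∑ i ∈ Finset.range k, μ.rowLen i := by
  rw [YoungDiagram.card, Finset.card_eq_sum_card_fiberwise (f := Prod.fst) (t := Finset.range k)]
  · exact Finset.sum_congr rfl fun i _ => (μ.rowLen_eq_card).symm
  · rintro ⟨i, j⟩ hc
    rw [Finset.mem_coe, mem_cells, mem_iff_lt_rowLen] at hc
    simp only [Finset.coe_range, Set.mem_Iio]
    by_contra! hi
    have := μ.rowLen_anti _ _ hi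
    omega

/-- Makes the exponent in `stripWeight` additive over rows, so that a strip weight is a product of
row weights. -/
theorem card_sub_card {ν μ : YoungDiagram} (h : ν ≤ μ) {k : ℕ} (hk : μ.rowLen k = 0) :
    μ.card - ν.card = ∑ i ∈ Finset.range k, (μ.rowLen i - ν.rowLen i) := by
  have h' := le_iff_rowLen.1 h
  have := h' k
  rw [card_eq_sum_rowLen μ hk, card_eq_sum_rowLen ν (k := k) (by omega),
    Finset.sum_tsub_distrib _ fun i _ => h' i]

theorem card_transpose (μ : YoungDiagram) : μ.transpose.card = μ.card :=
  Finset.card_map _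

theorem finite_subset (s : Finset (ℕ × ℕ)) : {μ : YoungDiagram | μ.cells ⊆ s}.Finite := by
  refine Set.Finite.of_finite_image (f := YoungDiagram.cells)
    (s.powerset.finite_toSet.subset ?_) ?_
  · rintro _ ⟨μ, hμ, rfl⟩
    exact Finset.mem_coe.2 (Finset.mem_powerset.2 hμ)
  · intro μ _ ν _ h
    exact YoungDiagram.ext h

/-- The finite set of diagrams with at most `n` rows and at most `m` columns. -/
noncomputable def box (n m : ℕ) : Finset YoungDiagram :=
  (finite_subset (Finset.range n ×ˢ Finset.range m)).toFinset

theorem mem_box {n m : ℕ} {μ : YoungDiagram} :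
    μ ∈ box n m ↔ ∀ c ∈ μ, c.1 < n ∧ c.2 < m := by
  simp [box, Finset.subset_iff]

theorem mem_box_iff_rowLen {n m : ℕ} {μ : YoungDiagram} :
    μ ∈ box n m ↔ μ.rowLen n = 0 ∧ μ.rowLen 0 ≤ m := by
  rw [mem_box]
  constructor
  · intro h
    constructor
    · by_contra h0
      have := h (n, 0) (mem_iff_lt_rowLen.2 (Nat.pos_of_ne_zero h0))
      simp at this
    · by_contra! h0
      have := h (0, m) (mem_iff_lt_rowLen.2 h0)
      simp at this
  · rintro ⟨h1, h2⟩ ⟨i, j⟩ hc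
    rw [mem_iff_lt_rowLen] at hc
    constructor <;> dsimp only
    · by_contra! hi
      have := μ.rowLen_anti _ _ hi
      omega
    · have := μ.rowLen_anti _ _ (Nat.zero_le i)
      omega

theorem mem_box_of_le {n m : ℕ} {ν μ : YoungDiagram} (h : ν ≤ μ) (hμ : μ ∈ box n m) :
    ν ∈ box n m :=
  mem_box.2 fun c hc => mem_box.1 hμ c (h hc)

theorem transpose_mem_box {n m : ℕ} {μ : YoungDiagram} :
    μ.transpose ∈ box m n ↔ μ ∈ box n m := by
  simp only [mem_box, mem_transpose, Prod.forall, Prod.swap_prod_mk]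
  exact ⟨fun h i j hc => (h j i hc).symm, fun h i j hc => (h j i hc).symm⟩

/-- The largest diagram with at most `k` rows whose `i`-th row has length at most `f i`. -/
def ofRows {k : ℕ} (f : Fin k → ℕ) : YoungDiagram where
  cells := (Finset.range k ×ˢ Finset.range (Finset.univ.sup f)).filter
    fun c => ∀ i : Fin k, i.1 ≤ c.1 → c.2 < f i
  isLowerSet := by
    rintro ⟨i, j⟩ ⟨i', j'⟩ ⟨h1, h2⟩ hc
    simp only [Finset.coe_filter, Finset.mem_product, Finset.mem_range, Set.mem_ofPred_eq] at hc ⊢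
    dsimp at h1 h2
    exact ⟨⟨by omega, by omega⟩, fun l hl => h2.trans_lt (hc.2 l (hl.trans h1))⟩

theorem mem_ofRows {k : ℕ} {f : Fin k → ℕ} {c : ℕ × ℕ} :
    c ∈ ofRows f ↔ c.1 < k ∧ ∀ i : Fin k, i.1 ≤ c.1 → c.2 < f i := by
  rw [← mem_cells, ofRows, Finset.mem_filter, Finset.mem_product, Finset.mem_range, Finset.mem_range]
  constructor
  · exact fun h => ⟨h.1.1, h.2⟩
  · exact fun h => ⟨⟨h.1, (h.2 ⟨c.1, h.1⟩ le_rfl).trans_le (Finset.le_sup (Finset.mem_univ _))⟩, h.2⟩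

theorem rowLen_ofRows {k : ℕ} {f : Fin k → ℕ} (hf : Antitone f) (i : Fin k) :
    (ofRows f).rowLen i = f i := by
  refine eq_of_forall_lt_iff fun j => ?_
  rw [← mem_iff_lt_rowLen, mem_ofRows]
  exact ⟨fun h => h.2 i le_rfl, fun h => ⟨i.2, fun l hl => h.trans_le (hf hl)⟩⟩

theorem rowLen_ofRows_self {k : ℕ} {f : Fin k → ℕ} : (ofRows f).rowLen k = 0 := by
  by_contra h
  have := mem_ofRows.1 (mem_iff_lt_rowLen.2 (Nat.pos_of_ne_zero h))
  exact lt_irrefl _ this.1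

/-- Summing a product of row weights over the diagrams whose rows range over consecutive intervals
amounts to multiplying the sums over the single rows. -/
theorem sum_prod_rowLen {A : Type*} [CommRing A] (k m : ℕ) (lo hi : ℕ → ℕ)
    (hlohi : ∀ i, hi (i + 1) ≤ lo i) (hm : hi 0 ≤ m) (w : ℕ → ℕ → A) :
    ∑ μ ∈ (box (k + 1) m).filter
        (fun μ => ∀ i < k + 1, μ.rowLen i ∈ Finset.Icc (lo i) (hi i)),
      ∏ i ∈ Finset.range (k + 1), w i (μ.rowLen i) =
    ∏ i ∈ Finset.range (k + 1), ∑ l ∈ Finset.Icc (lo i) (hi i), w i l := by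
  rw [Finset.prod_range, Finset.prod_univ_sum]
  -- Since `hi (i + 1) ≤ lo i`, any independent choice of row lengths is weakly decreasing, so being
  -- a partition imposes no further condition.
  have anti : ∀ f ∈ Fintype.piFinset fun i : Fin (k + 1) => Finset.Icc (lo i) (hi i),
      Antitone f := by
    intro f hf
    rw [Fintype.mem_piFinset] at hf
    refine Fin.antitone_iff_succ_le.2 fun i => ?_
    have h1 := Finset.mem_Icc.1 (hf i.succ)
    have h2 := Finset.mem_Icc.1 (hf i.castSucc)
    have h3 := hlohi i
    simp only [Fin.val_succ, Fin.val_castSucc] at h1 h2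
    omega
  refine Finset.sum_nbij' (fun μ i => μ.rowLen i) (fun f => ofRows f) ?_ ?_ ?_ ?_ ?_
  · intro μ hμ
    rw [Finset.mem_filter] at hμ
    exact Fintype.mem_piFinset.2 fun i => hμ.2 i i.2
  · intro f hf
    have ha := anti f hf
    rw [Fintype.mem_piFinset] at hf
    refine Finset.mem_filter.2 ⟨mem_box_iff_rowLen.2 ⟨rowLen_ofRows_self, ?_⟩, fun i hi => ?_⟩
    · have h0 := rowLen_ofRows ha 0
      have h1 := Finset.mem_Icc.1 (hf 0)
      simp only [Fin.val_zero] at h0 h1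
      omega
    · have := rowLen_ofRows ha ⟨i, hi⟩
      dsimp only at this
      rw [this]
      exact hf ⟨i, hi⟩
  · intro μ hμ
    rw [Finset.mem_filter, mem_box_iff_rowLen] at hμ
    have ha : Antitone fun i : Fin (k + 1) => μ.rowLen i := fun i j hij => μ.rowLen_anti _ _ hij
    refine ext_rowLen fun i => ?_
    rcases lt_or_ge i (k + 1) with hi | hi
    · exact rowLen_ofRows ha ⟨i, hi⟩
    · have h1 := μ.rowLen_anti _ _ hi
      have h2 := (ofRows fun i : Fin (k + 1) => μ.rowLen i).rowLen_anti _ _ hi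
      rw [rowLen_ofRows_self] at h2
      omega
  · intro f hf
    funext i
    exact rowLen_ofRows (anti f hf) i
  · intro μ _
    exact Finset.prod_range _

/-! ### Commutation of horizontal and vertical strips -/

section Commutation

variable {A : Type*} [CommRing A] (x y : A)

open Classical in
/-- The weight `x ^ |μ / ν|` of a horizontal strip `μ / ν`, zero for other skew shapes. -/
noncomputable def stripWeight (ν μ : YoungDiagram) : A :=
  if IsHorizontalStrip ν μ then x ^ (μ.card - ν.card) else 0

/-- The weight of the boundary between two consecutive rows in the commutation relation. -/
def gapWeight (p q : ℕ) : A :=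
  if p < q then 0 else if p = q then 1 else 1 + x * y

/-- Here `a`, `b` are the current rows of `α`, `β`, while `a'` is the row of `α` above and `b'` the
row of `β` below. For `a ≤ b` each sum has at most two terms and equals `x ^ (b - a)` times the gap
weight opposite to it. For `a = b + 1` both sums are `y` and both gap weights are `1 + x * y`; for
larger `a` both sums are empty. -/
theorem sum_row_mul_gapWeight (a' a b b' : ℕ) (ha : a ≤ a') (hb : b' ≤ b) :
    (∑ l ∈ Finset.Icc (max a b) (min a' (b + 1)), x ^ (l - a) * y ^ (l - b)) *
        gapWeight x y a b' =
      gapWeight x y a' b *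
        ∑ l ∈ Finset.Icc (max b' (a - 1)) (min a b), x ^ (b - l) * y ^ (a - l) := by
  rcases lt_or_ge (b + 1) a with h1 | h1
  · rw [Finset.Icc_eq_empty (by omega), Finset.Icc_eq_empty (by omega)]
    simp
  rcases lt_or_ge b a with h2 | h2
  · obtain rfl : a = b + 1 := by omega
    have e1 : Finset.Icc (max (b + 1) b) (min a' (b + 1)) = {b + 1} := by
      ext; simp; omega
    have e2 : Finset.Icc (max b' (b + 1 - 1)) (min (b + 1) b) = {b} := by
      ext; simp; omega
    rw [e1, e2, gapWeight, gapWeight, if_neg (by omega), if_neg (by omega), if_neg (by omega),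
      if_neg (by omega)]
    simp
    ring
  have e1 : (∑ l ∈ Finset.Icc (max a b) (min a' (b + 1)), x ^ (l - a) * y ^ (l - b)) =
      x ^ (b - a) * gapWeight x y a' b := by
    rw [gapWeight]
    split_ifs with h3 h4
    · rw [Finset.Icc_eq_empty (by omega)]; simp
    · have : Finset.Icc (max a b) (min a' (b + 1)) = {b} := by ext; simp; omega
      rw [this]; simp
    · have : Finset.Icc (max a b) (min a' (b + 1)) = {b, b + 1} := by ext; simp; omega
      rw [this, Finset.sum_pair (by omega), Nat.sub_add_comm h2]
      simp
      ring
  have e2 : (∑ l ∈ Finset.Icc (max b' (a - 1)) (min a b), x ^ (b - l) * y ^ (a - l)) =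
      x ^ (b - a) * gapWeight x y a b' := by
    rw [gapWeight]
    split_ifs with h3 h4
    · rw [Finset.Icc_eq_empty (by omega)]; simp
    · have : Finset.Icc (max b' (a - 1)) (min a b) = {a} := by ext; simp; omega
      rw [this]; simp
    · obtain ⟨a, rfl⟩ : ∃ c, a = c + 1 := ⟨a - 1, by omega⟩
      have : Finset.Icc (max b' (a + 1 - 1)) (min (a + 1) b) = {a, a + 1} := by
        ext; simp; omega
      have e : b - a = b - (a + 1) + 1 := by omega
      rw [this, Finset.sum_pair (by omega), e]
      simp
      ring
  rw [e1, e2]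
  ring

/-- Adding a horizontal strip and removing a vertical strip commute up to a factor `1 + x * y`. -/
theorem sum_stripWeight_mul_stripWeight {k m : ℕ} {α β : YoungDiagram} (hα : α ∈ box k (m + 1))
    (hβ : β ∈ box (k + 1) m) :
    ∑ μ ∈ box (k + 1) (m + 1), stripWeight x α μ * stripWeight y β.transpose μ.transpose =
      (1 + x * y) * ∑ ν ∈ box (k + 1) (m + 1),
        stripWeight x ν β * stripWeight y ν.transpose α.transpose := by
  classical
  rw [mem_box_iff_rowLen] at hα hβ
  -- The row of `α` above row `i`. Row `0` has none: the value `β.rowLen 0 + 1` leaves the vertical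
  -- strip bound as the only upper bound there, and makes the initial gap weight `1 + x * y`.
  let a' : ℕ → ℕ := fun i => Nat.casesOn i (β.rowLen 0 + 1) fun j => α.rowLen j
  have ha0 : a' 0 = β.rowLen 0 + 1 := rfl
  have haS : ∀ i, a' (i + 1) = α.rowLen i := fun _ => rfl
  have hleft : ∑ μ ∈ box (k + 1) (m + 1),
      stripWeight x α μ * stripWeight y β.transpose μ.transpose =
      ∏ i ∈ Finset.range (k + 1), ∑ l ∈ Finset.Icc (max (α.rowLen i) (β.rowLen i))
        (min (a' i) (β.rowLen i + 1)), x ^ (l - α.rowLen i) * y ^ (l - β.rowLen i) := by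
    rw [← sum_prod_rowLen k (m + 1) _ _ (fun i => ?_) (by omega), Finset.sum_filter]
    · refine Finset.sum_congr rfl fun μ hμ => ?_
      rw [mem_box_iff_rowLen] at hμ
      have hiff : (∀ i < k + 1, μ.rowLen i ∈ Finset.Icc (max (α.rowLen i) (β.rowLen i))
          (min (a' i) (β.rowLen i + 1))) ↔
          IsHorizontalStrip α μ ∧ IsHorizontalStrip β.transpose μ.transpose := by
        rw [isHorizontalStrip_iff_rowLen, isHorizontalStrip_transpose_iff_rowLen, ← forall_and]
        constructor
        · intro h i
          rcases lt_or_ge i (k + 1) with hi | hi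
          · have h1 := Finset.mem_Icc.1 (h i hi)
            rcases lt_or_ge (i + 1) (k + 1) with hi' | hi'
            · have h2 := Finset.mem_Icc.1 (h (i + 1) hi')
              rw [haS] at h2
              omega
            · have h2 := μ.rowLen_anti _ _ hi'
              omega
          · have h1 := μ.rowLen_anti _ _ hi
            have h2 := μ.rowLen_anti i (i + 1) (by omega)
            have h3 := α.rowLen_anti k i (by omega)
            have h4 := β.rowLen_anti _ _ hi
            omega
        · intro h i hi
          have h1 := h i
          rw [Finset.mem_Icc]
          rcases i with _ | i
          · omega
          · have h2 := h i
            have h3 := haS i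
            omega
      by_cases h : IsHorizontalStrip α μ ∧ IsHorizontalStrip β.transpose μ.transpose
      · rw [if_pos (hiff.2 h), stripWeight, stripWeight, if_pos h.1, if_pos h.2,
          card_transpose, card_transpose, card_sub_card h.1.1 hμ.1,
          card_sub_card (transpose_le_iff.1 h.2.1) hμ.1, Finset.prod_mul_distrib,
          Finset.prod_pow_eq_pow_sum, Finset.prod_pow_eq_pow_sum]
      · rw [if_neg (mt hiff.1 h), stripWeight, stripWeight]
        rw [not_and_or] at h
        rcases h with h | h <;> simp [h]
    · have := haS i
      omega
  have hright : ∑ ν ∈ box (k + 1) (m + 1),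
      stripWeight x ν β * stripWeight y ν.transpose α.transpose =
      ∏ i ∈ Finset.range (k + 1), ∑ l ∈ Finset.Icc (max (β.rowLen (i + 1)) (α.rowLen i - 1))
        (min (α.rowLen i) (β.rowLen i)), x ^ (β.rowLen i - l) * y ^ (α.rowLen i - l) := by
    rw [← sum_prod_rowLen k (m + 1) _ _ (fun i => by omega) (by omega), Finset.sum_filter]
    refine Finset.sum_congr rfl fun ν hν => ?_
    rw [mem_box_iff_rowLen] at hν
    have hαk : α.rowLen (k + 1) = 0 := by
      have := α.rowLen_anti k (k + 1) (by omega)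
      omega
    have hiff : (∀ i < k + 1, ν.rowLen i ∈ Finset.Icc (max (β.rowLen (i + 1)) (α.rowLen i - 1))
        (min (α.rowLen i) (β.rowLen i))) ↔
        IsHorizontalStrip ν β ∧ IsHorizontalStrip ν.transpose α.transpose := by
      rw [isHorizontalStrip_iff_rowLen, isHorizontalStrip_transpose_iff_rowLen, ← forall_and]
      constructor
      · intro h i
        rcases lt_or_ge i (k + 1) with hi | hi
        · have h1 := Finset.mem_Icc.1 (h i hi)
          omega
        · have h1 := ν.rowLen_anti _ _ hi
          have h2 := β.rowLen_anti _ _ hi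
          have h3 := α.rowLen_anti _ _ hi
          have h4 := β.rowLen_anti i (i + 1) (by omega)
          omega
      · intro h i hi
        have h1 := h i
        rw [Finset.mem_Icc]
        omega
    by_cases h : IsHorizontalStrip ν β ∧ IsHorizontalStrip ν.transpose α.transpose
    · rw [if_pos (hiff.2 h), stripWeight, stripWeight, if_pos h.1, if_pos h.2,
        card_transpose, card_transpose, card_sub_card h.1.1 hβ.1,
        card_sub_card (transpose_le_iff.1 h.2.1) hαk, Finset.prod_mul_distrib,
        Finset.prod_pow_eq_pow_sum, Finset.prod_pow_eq_pow_sum]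
    · rw [if_neg (mt hiff.1 h), stripWeight, stripWeight]
      rw [not_and_or] at h
      rcases h with h | h <;> simp [h]
  -- Telescoping over rows: the gap weight below one row is the gap weight above the next.
  have key : ∀ n, (∏ i ∈ Finset.range n, ∑ l ∈ Finset.Icc (max (α.rowLen i) (β.rowLen i))
        (min (a' i) (β.rowLen i + 1)), x ^ (l - α.rowLen i) * y ^ (l - β.rowLen i)) *
        gapWeight x y (a' n) (β.rowLen n) =
      (1 + x * y) * ∏ i ∈ Finset.range n,
        ∑ l ∈ Finset.Icc (max (β.rowLen (i + 1)) (α.rowLen i - 1))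
        (min (α.rowLen i) (β.rowLen i)), x ^ (β.rowLen i - l) * y ^ (α.rowLen i - l) := by
    intro n
    induction n with
    | zero => simp [ha0, gapWeight]
    | succ n ih =>
      have hb := β.rowLen_anti n (n + 1) (by omega)
      rw [Finset.prod_range_succ, Finset.prod_range_succ, ← mul_assoc, ← ih, mul_assoc, mul_assoc]
      congr 1
      rcases n with _ | n
      · rcases le_or_gt (α.rowLen 0) (β.rowLen 0 + 1) with h | h
        · exact sum_row_mul_gapWeight x y _ _ _ _ h hb
        -- In row `0` the artificial `a'` may fall below `α.rowLen 0`, but then both row sums are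
        -- empty.
        · rw [Finset.Icc_eq_empty (by omega), Finset.Icc_eq_empty (by omega)]
          simp
      · exact sum_row_mul_gapWeight x y _ _ _ _ (α.rowLen_anti n (n + 1) (by omega)) hb
  have := key (k + 1)
  rw [hleft, hright, ← this]
  -- The last gap compares two zero rows, so its weight is `1`.
  simp [haS, gapWeight, hα.1, hβ.1]

end Commutation

end YoungDiagram

open YoungDiagram

/-! ### Removing and adding the largest letter of a tableau -/

namespace SemistandardYoungTableau

variable {μ ν : YoungDiagram}

/-- The cells of a tableau with entries below `n` form a Young diagram. -/
def shapeBelow (T : SemistandardYoungTableau μ) (n : ℕ) : YoungDiagram where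
  cells := μ.cells.filter fun c => T c.1 c.2 < n
  isLowerSet := by
    rintro ⟨i, j⟩ ⟨i', j'⟩ ⟨h1, h2⟩ hc
    simp only [Finset.coe_filter, Set.mem_ofPred_eq, mem_cells] at hc ⊢
    dsimp only at h1 h2
    have hm : (i', j) ∈ μ := μ.up_left_mem h1 le_rfl hc.1
    exact ⟨μ.up_left_mem h1 h2 hc.1,
      (T.row_weak_of_le h2 hm).trans_lt ((T.col_weak h1 hc.1).trans_lt hc.2)⟩

theorem mem_shapeBelow (T : SemistandardYoungTableau μ) (n : ℕ) {c : ℕ × ℕ} :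
    c ∈ T.shapeBelow n ↔ c ∈ μ ∧ T c.1 c.2 < n := by
  rw [← mem_cells, shapeBelow, Finset.mem_filter, mem_cells]

theorem shapeBelow_le (T : SemistandardYoungTableau μ) (n : ℕ) : T.shapeBelow n ≤ μ :=
  fun _ hc => ((T.mem_shapeBelow n).1 hc).1

/-- Columns increase strictly, so a cell directly above another one has an entry below the maximal
letter `n`. -/
theorem isHorizontalStrip_shapeBelow (T : SemistandardYoungTableau μ) {n : ℕ}
    (hT : ∀ c ∈ μ.cells, T c.1 c.2 < n + 1) : IsHorizontalStrip (T.shapeBelow n) μ := by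
  refine ⟨T.shapeBelow_le n, fun i j hc => (T.mem_shapeBelow n).2
    ⟨μ.up_left_mem (Nat.le_succ i) le_rfl hc, ?_⟩⟩
  have h1 := hT _ ((mem_cells _).2 hc)
  have h2 := T.col_strict (Nat.lt_add_one i) hc
  dsimp only at h1 ⊢
  omega

/-- The restriction of a tableau to a smaller shape. -/
def restrict (T : SemistandardYoungTableau μ) (h : ν ≤ μ) : SemistandardYoungTableau ν where
  entry i j := if (i, j) ∈ ν then T i j else 0
  row_weak' {i j1 j2} hj hc := by
    rw [if_pos hc, if_pos (ν.up_left_mem le_rfl hj.le hc)]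
    exact T.row_weak hj (h hc)
  col_strict' {i1 i2 j} hi hc := by
    rw [if_pos hc, if_pos (ν.up_left_mem hi.le le_rfl hc)]
    exact T.col_strict hi (h hc)
  zeros' hc := if_neg hc

theorem restrict_apply (T : SemistandardYoungTableau μ) (h : ν ≤ μ) (i j : ℕ) :
    T.restrict h i j = if (i, j) ∈ ν then T i j else 0 := rfl

/-- The extension of a tableau by a horizontal strip filled with the letter `n`. -/
def extend (S : SemistandardYoungTableau ν) {n : ℕ} (hS : ∀ c ∈ ν.cells, S c.1 c.2 < n)
    (h : IsHorizontalStrip ν μ) : SemistandardYoungTableau μ where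
  entry i j := if (i, j) ∈ ν then S i j else if (i, j) ∈ μ then n else 0
  row_weak' {i j1 j2} hj hc := by
    by_cases h2 : (i, j2) ∈ ν
    · rw [if_pos h2, if_pos (ν.up_left_mem le_rfl hj.le h2)]
      exact S.row_weak hj h2
    · rw [if_neg h2, if_pos hc]
      split_ifs with h1
      · exact (hS _ ((mem_cells _).2 h1)).le
      · exact le_rfl
      · exact Nat.zero_le _
  col_strict' {i1 i2 j} hi hc := by
    -- Any cell with a cell of `μ` below it lies in `ν`, so two new letters never meet in a column.
    have h1 : (i1, j) ∈ ν := by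
      obtain ⟨k, rfl⟩ : ∃ k, i2 = k + 1 := ⟨i2 - 1, by omega⟩
      exact ν.up_left_mem (Nat.lt_succ_iff.1 hi) le_rfl (h.2 _ _ hc)
    rw [if_pos h1]
    split_ifs with h2
    · exact S.col_strict hi h2
    · exact hS _ ((mem_cells _).2 h1)
  zeros' hc := by rw [if_neg fun h' => hc (h.1 h'), if_neg hc]

theorem extend_apply (S : SemistandardYoungTableau ν) {n : ℕ}
    (hS : ∀ c ∈ ν.cells, S c.1 c.2 < n) (h : IsHorizontalStrip ν μ) (i j : ℕ) :
    S.extend hS h i j = if (i, j) ∈ ν then S i j else if (i, j) ∈ μ then n else 0 := rfl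

theorem extend_lt (S : SemistandardYoungTableau ν) {n : ℕ}
    (hS : ∀ c ∈ ν.cells, S c.1 c.2 < n) (h : IsHorizontalStrip ν μ) :
    ∀ c ∈ μ.cells, S.extend hS h c.1 c.2 < n + 1 := by
  intro c hc
  rw [extend_apply]
  split_ifs with h1
  · exact (hS _ ((mem_cells _).2 h1)).trans (Nat.lt_succ_self n)
  · exact Nat.lt_succ_self n
  · exact Nat.succ_pos n

theorem shapeBelow_extend (S : SemistandardYoungTableau ν) {n : ℕ}
    (hS : ∀ c ∈ ν.cells, S c.1 c.2 < n) (h : IsHorizontalStrip ν μ) :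
    (S.extend hS h).shapeBelow n = ν := by
  refine SetLike.ext fun c => ?_
  rw [mem_shapeBelow, extend_apply]
  constructor
  · rintro ⟨h1, h2⟩
    by_contra h3
    rw [if_neg h3, if_pos h1] at h2
    exact lt_irrefl _ h2
  · intro h1
    rw [if_pos h1]
    exact ⟨h.1 h1, hS _ ((mem_cells _).2 h1)⟩

theorem restrict_extend (S : SemistandardYoungTableau ν) {n : ℕ}
    (hS : ∀ c ∈ ν.cells, S c.1 c.2 < n) (h : IsHorizontalStrip ν μ) :
    (S.extend hS h).restrict h.1 = S := by
  ext i j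
  rw [restrict_apply, extend_apply]
  split_ifs with h1
  · rfl
  · rw [S.zeros h1]

theorem restrict_lt (T : SemistandardYoungTableau μ) {n : ℕ} (h : T.shapeBelow n = ν) (h' : ν ≤ μ) :
    ∀ c ∈ ν.cells, T.restrict h' c.1 c.2 < n := by
  intro c hc
  rw [mem_cells] at hc
  rw [restrict_apply, if_pos hc]
  rw [← h] at hc
  exact ((T.mem_shapeBelow n).1 hc).2

theorem extend_restrict (T : SemistandardYoungTableau μ) {n : ℕ}
    (hT : ∀ c ∈ μ.cells, T c.1 c.2 < n + 1) (h : T.shapeBelow n = ν)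
    (h' : IsHorizontalStrip ν μ) :
    (T.restrict h'.1).extend (T.restrict_lt h h'.1) h' = T := by
  ext i j
  rw [extend_apply, restrict_apply]
  split_ifs with h1 h2
  · rfl
  · have h3 := hT _ ((mem_cells _).2 h2)
    have h4 : ¬ T i j < n := fun h4 => h1 (h ▸ (T.mem_shapeBelow n).2 ⟨h2, h4⟩)
    dsimp only at h3
    omega
  · rw [T.zeros h2]

end SemistandardYoungTableau

/-! ### Branching rule, dual Pieri rule and the finite identity -/

section SchurEval

variable {A : Type*} [CommRing A]

open SemistandardYoungTableau

/-- The evaluation of the Schur polynomial of `μ` in `n` variables at `x 0, …, x (n - 1)`. -/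
noncomputable def schurEval (x : ℕ → A) (n : ℕ) (μ : YoungDiagram) : A :=
  ∑ T : {T : SemistandardYoungTableau μ // ∀ c ∈ μ.cells, T c.1 c.2 < n},
    ∏ c ∈ μ.cells, x (T.1 c.1 c.2)

theorem schurEval_bot (x : ℕ → A) (n : ℕ) : schurEval x n ⊥ = 1 := by
  rw [schurEval]
  have : Unique {T : SemistandardYoungTableau ⊥ // ∀ c ∈ (⊥ : YoungDiagram).cells, T c.1 c.2 < n} :=
    { default := ⟨highestWeight ⊥, by simp⟩
      uniq := fun T => by
        refine Subtype.ext (SemistandardYoungTableau.ext fun i j => ?_)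
        rw [T.1.zeros (notMem_bot _), (highestWeight ⊥).zeros (notMem_bot _)] }
  rw [Fintype.sum_unique]
  simp

/-- The entries in row `i` are at least `i`. -/
theorem SemistandardYoungTableau.le_apply {μ : YoungDiagram} (T : SemistandardYoungTableau μ)
    {i j : ℕ} (h : (i, j) ∈ μ) : i ≤ T i j := by
  induction i with
  | zero => exact Nat.zero_le _
  | succ i ih =>
    have h1 := ih (μ.up_left_mem (Nat.le_succ i) le_rfl h)
    have h2 := T.col_strict (Nat.lt_add_one i) h
    omega

/-- A cell in row `n` would need an entry at least `n`, by strictness of columns. -/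
theorem schurEval_eq_zero (x : ℕ → A) {n : ℕ} {μ : YoungDiagram} (h : μ.rowLen n ≠ 0) :
    schurEval x n μ = 0 := by
  have : IsEmpty {T : SemistandardYoungTableau μ // ∀ c ∈ μ.cells, T c.1 c.2 < n} := by
    refine ⟨fun T => ?_⟩
    have hc : (n, 0) ∈ μ := mem_iff_lt_rowLen.2 (Nat.pos_of_ne_zero h)
    have h1 := T.2 _ ((mem_cells _).2 hc)
    have h2 := T.1.le_apply hc
    dsimp only at h1
    omega
  rw [schurEval, Fintype.sum_empty]

/-- The branching rule for Schur polynomials. -/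
theorem schurEval_succ (x : ℕ → A) (n : ℕ) {μ : YoungDiagram} {Ω : Finset YoungDiagram}
    (hΩ : ∀ ν ≤ μ, ν ∈ Ω) :
    schurEval x (n + 1) μ = ∑ ν ∈ Ω, stripWeight (x n) ν μ * schurEval x n ν := by
  classical
  -- Tableaux are grouped by the shape `ν` of their entries below `n`; the cells outside `ν` all
  -- carry `n` and contribute the strip weight.
  rw [schurEval, ← Finset.sum_fiberwise_of_maps_to (s := Finset.univ) (t := Ω)
    (g := fun T => T.1.shapeBelow n) fun T _ => hΩ _ (T.1.shapeBelow_le n)]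
  refine Finset.sum_congr rfl fun ν _ => ?_
  rw [stripWeight]
  split_ifs with h
  · rw [schurEval, Finset.mul_sum]
    refine Finset.sum_bij' (fun T hT => ⟨T.1.restrict h.1,
        T.1.restrict_lt (Finset.mem_filter.1 hT).2 h.1⟩)
      (fun S _ => ⟨S.1.extend S.2 h, S.1.extend_lt S.2 h⟩) ?_ ?_ ?_ ?_ ?_
    · exact fun T hT => Finset.mem_univ _
    · exact fun S _ => Finset.mem_filter.2 ⟨Finset.mem_univ _, S.1.shapeBelow_extend S.2 h⟩
    · exact fun T hT => Subtype.ext (T.1.extend_restrict T.2 (Finset.mem_filter.1 hT).2 h)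
    · exact fun S _ => Subtype.ext (S.1.restrict_extend S.2 h)
    · intro T hT
      have hT := (Finset.mem_filter.1 hT).2
      rw [← Finset.prod_sdiff (cells_subset_iff.2 h.1),
        ← Finset.card_sdiff_of_subset (cells_subset_iff.2 h.1)]
      congr 1
      · refine Finset.prod_eq_pow_card fun c hc => ?_
        rw [Finset.mem_sdiff, mem_cells, ← hT, mem_cells, mem_shapeBelow] at hc
        have h1 := T.2 c ((mem_cells _).2 hc.1)
        congr 1
        by_contra h2
        exact hc.2 ⟨hc.1, by omega⟩
      · refine Finset.prod_congr rfl fun c hc => ?_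
        rw [restrict_apply, if_pos ((mem_cells _).1 hc)]
  · rw [zero_mul, Finset.filter_eq_empty_iff.2, Finset.sum_empty]
    rintro T - rfl
    exact h (T.1.isHorizontalStrip_shapeBelow T.2)

theorem transpose_bot : (⊥ : YoungDiagram).transpose = ⊥ :=
  SetLike.ext fun c => by simp

/-- The branching rule reindexed by conjugation, so that its sum runs over the same box as the other
sums. -/
theorem schurEval_transpose_succ (y : ℕ → A) (m : ℕ) {n k : ℕ} {μ : YoungDiagram}
    (hμ : μ ∈ box n k) :
    schurEval y (m + 1) μ.transpose = ∑ ν ∈ box n k,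
      stripWeight (y m) ν.transpose μ.transpose * schurEval y m ν.transpose := by
  rw [schurEval_succ y m (Ω := box k n)
    fun ν hν => mem_box_of_le hν (transpose_mem_box.2 hμ)]
  refine Finset.sum_nbij' transpose transpose ?_ ?_ ?_ ?_ ?_
  · exact fun ν hν => transpose_mem_box.2 hν
  · exact fun ν hν => transpose_mem_box.2 hν
  · exact fun ν _ => ν.transpose_transpose
  · exact fun ν _ => ν.transpose_transpose
  · exact fun ν _ => by rw [ν.transpose_transpose]

theorem schurEval_transpose_eq_zero (y : ℕ → A) {m : ℕ} {μ : YoungDiagram} (h : m < μ.rowLen 0) :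
    schurEval y m μ.transpose = 0 := by
  refine schurEval_eq_zero y fun h0 => ?_
  have : (m, 0) ∈ μ.transpose := mem_transpose.2 (mem_iff_lt_rowLen.2 h)
  rw [mem_iff_lt_rowLen] at this
  omega

theorem eq_bot_of_rowLen_zero {μ : YoungDiagram} (h : μ.rowLen 0 = 0) : μ = ⊥ := by
  refine eq_bot_iff.2 fun c hc => ?_
  have h1 := mem_iff_lt_rowLen.1 (μ.up_left_mem (Nat.zero_le c.1) (Nat.zero_le c.2) hc)
  omega

theorem stripWeight_self (x : A) (μ : YoungDiagram) : stripWeight x μ μ = 1 := by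
  rw [stripWeight, if_pos, Nat.sub_self, pow_zero]
  exact ⟨le_rfl, fun i j h => μ.up_left_mem (Nat.le_succ i) le_rfl h⟩

theorem stripWeight_eq_zero (x : A) {ν μ : YoungDiagram} (h : ¬ ν ≤ μ) : stripWeight x ν μ = 0 :=
  if_neg fun h' => h h'.1

/-- The dual Pieri rule, summed over all strip lengths. -/
theorem sum_stripWeight_mul_schurEval (x : A) (y : ℕ → A) (k : ℕ) {m M : ℕ} (hm : m ≤ M)
    {α : YoungDiagram} (hα : α ∈ box k (M + 1)) :
    ∑ μ ∈ box (k + 1) (M + 1), stripWeight x α μ * schurEval y m μ.transpose =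
      (∏ j ∈ Finset.range m, (1 + x * y j)) * schurEval y m α.transpose := by
  have hsub : ∀ {ν : YoungDiagram}, ν ∈ box k (M + 1) → ν ∈ box (k + 1) (M + 1) := fun hν => by
    rw [mem_box] at hν ⊢
    exact fun c hc => ⟨(hν c hc).1.trans (Nat.lt_succ_self k), (hν c hc).2⟩
  induction m generalizing α with
  | zero =>
    have hzero : ∀ μ : YoungDiagram, μ ≠ ⊥ → schurEval y 0 μ.transpose = 0 := fun μ h =>
      schurEval_transpose_eq_zero y (Nat.pos_of_ne_zero fun h0 => h (eq_bot_of_rowLen_zero h0))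
    rw [Finset.prod_range_zero, one_mul, Finset.sum_eq_single ⊥]
    · by_cases h : α = ⊥
      · rw [h, stripWeight_self, one_mul]
      · rw [stripWeight_eq_zero x fun h' => h (le_bot_iff.1 h'), hzero α h, zero_mul]
    · exact fun μ _ h => by rw [hzero μ h, mul_zero]
    · exact fun h => absurd (mem_box_of_le bot_le (hsub hα)) h
  | succ m ih =>
    calc ∑ μ ∈ box (k + 1) (M + 1), stripWeight x α μ * schurEval y (m + 1) μ.transpose
        = ∑ μ ∈ box (k + 1) (M + 1), ∑ β ∈ box (k + 1) (M + 1), stripWeight x α μ *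
          (stripWeight (y m) β.transpose μ.transpose * schurEval y m β.transpose) :=
          Finset.sum_congr rfl fun μ hμ => by
            rw [schurEval_transpose_succ y m hμ, Finset.mul_sum]
      _ = ∑ β ∈ box (k + 1) (M + 1), (∑ μ ∈ box (k + 1) (M + 1), stripWeight x α μ *
          stripWeight (y m) β.transpose μ.transpose) * schurEval y m β.transpose := by
          rw [Finset.sum_comm]
          simp only [Finset.sum_mul, mul_assoc]
      _ = ∑ β ∈ box (k + 1) (M + 1), ((1 + x * y m) * ∑ ν ∈ box (k + 1) (M + 1),
          stripWeight x ν β * stripWeight (y m) ν.transpose α.transpose) *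
            schurEval y m β.transpose := by
          refine Finset.sum_congr rfl fun β hβ => ?_
          -- The commutation relation needs room for one more column; diagrams `β` with more than
          -- `m` columns contribute zero anyway.
          rcases lt_or_ge m (β.rowLen 0) with h | h
          · rw [schurEval_transpose_eq_zero y h, mul_zero, mul_zero]
          · have hβ' : β ∈ box (k + 1) M :=
              mem_box_iff_rowLen.2 ⟨(mem_box_iff_rowLen.1 hβ).1, by omega⟩
            rw [sum_stripWeight_mul_stripWeight x (y m) hα hβ']
      _ = (1 + x * y m) * ∑ ν ∈ box (k + 1) (M + 1),
          stripWeight (y m) ν.transpose α.transpose *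
            ∑ β ∈ box (k + 1) (M + 1), stripWeight x ν β * schurEval y m β.transpose := by
          simp only [Finset.mul_sum, Finset.sum_mul]
          rw [Finset.sum_comm]
          exact Finset.sum_congr rfl fun ν _ => Finset.sum_congr rfl fun β _ => by ring
      _ = (1 + x * y m) * ∑ ν ∈ box (k + 1) (M + 1),
          stripWeight (y m) ν.transpose α.transpose *
            ((∏ j ∈ Finset.range m, (1 + x * y j)) * schurEval y m ν.transpose) := by
          refine congrArg _ (Finset.sum_congr rfl fun ν _ => ?_)
          -- Only `ν ≤ α` carry weight, and these inherit from `α` the row bound needed for the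
          -- induction hypothesis.
          by_cases h : ν ≤ α
          · rw [ih (by omega) (mem_box_of_le h hα)]
          · rw [stripWeight_eq_zero _ (mt transpose_le_iff.1 h), zero_mul, zero_mul]
      _ = (∏ j ∈ Finset.range (m + 1), (1 + x * y j)) * schurEval y (m + 1) α.transpose := by
          rw [schurEval_transpose_succ y m (hsub hα), Finset.prod_range_succ, Finset.mul_sum,
            Finset.mul_sum]
          exact Finset.sum_congr rfl fun ν _ => by ring

/-- The dual Cauchy identity for finitely many elements of a commutative ring. -/
theorem sum_schurEval_mul_schurEval (x y : ℕ → A) {n m N M : ℕ} (hn : n ≤ N) (hm : m ≤ M) :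
    ∑ μ ∈ box (N + 1) (M + 1), schurEval x n μ * schurEval y m μ.transpose =
      ∏ i ∈ Finset.range n, ∏ j ∈ Finset.range m, (1 + x i * y j) := by
  induction n with
  | zero =>
    rw [Finset.prod_range_zero, Finset.sum_eq_single ⊥]
    · rw [transpose_bot, schurEval_bot, schurEval_bot, one_mul]
    · intro μ _ h
      rw [schurEval_eq_zero x fun h0 => h (eq_bot_of_rowLen_zero h0), zero_mul]
    · exact fun h => absurd (mem_box.2 fun c hc => absurd hc (notMem_bot c)) h
  | succ n ih =>
    calc ∑ μ ∈ box (N + 1) (M + 1), schurEval x (n + 1) μ * schurEval y m μ.transpose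
        = ∑ μ ∈ box (N + 1) (M + 1), ∑ ν ∈ box (N + 1) (M + 1),
          stripWeight (x n) ν μ * schurEval x n ν * schurEval y m μ.transpose :=
          Finset.sum_congr rfl fun μ hμ => by
            rw [schurEval_succ x n fun ν hν => mem_box_of_le hν hμ, Finset.sum_mul]
      _ = ∑ ν ∈ box (N + 1) (M + 1), schurEval x n ν *
          ∑ μ ∈ box (N + 1) (M + 1), stripWeight (x n) ν μ * schurEval y m μ.transpose := by
          rw [Finset.sum_comm]
          simp only [Finset.mul_sum]
          exact Finset.sum_congr rfl fun ν _ => Finset.sum_congr rfl fun μ _ => by ring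
      _ = ∑ ν ∈ box (N + 1) (M + 1), schurEval x n ν *
          ((∏ j ∈ Finset.range m, (1 + x n * y j)) * schurEval y m ν.transpose) := by
          refine Finset.sum_congr rfl fun ν hν => ?_
          -- The Pieri rule needs a spare row; diagrams with more than `n` rows have zero Schur
          -- value in `n` variables.
          by_cases h : ν.rowLen n = 0
          · have hν' : ν ∈ box N (M + 1) := by
              rw [mem_box_iff_rowLen] at hν ⊢
              have := ν.rowLen_anti n N (by omega)
              exact ⟨by omega, hν.2⟩
            rw [sum_stripWeight_mul_schurEval (x n) y N hm hν']
          · rw [schurEval_eq_zero x h, zero_mul, zero_mul]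
      _ = ∏ i ∈ Finset.range (n + 1), ∏ j ∈ Finset.range m, (1 + x i * y j) := by
          rw [Finset.prod_range_succ, ← ih (by omega), Finset.sum_mul]
          exact Finset.sum_congr rfl fun ν _ => by ring

end SchurEval

/-! ### Transfer to Schur polynomials -/

open YoungDiagram SemistandardYoungTableau

theorem SemistandardYoungTableau.prod_pow_content {A : Type*} [CommRing A] (x : ℕ → A)
    {μ : YoungDiagram} (T : SemistandardYoungTableau μ) {n : ℕ}
    (hT : ∀ c ∈ μ.cells, T c.1 c.2 < n) :
    ∏ i ∈ Finset.range n, x i ^ T.content i = ∏ c ∈ μ.cells, x (T c.1 c.2) := by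
  rw [← Finset.prod_fiberwise_of_maps_to (s := μ.cells) (t := Finset.range n)
    (g := fun c => T c.1 c.2) fun c hc => Finset.mem_range.2 (hT c hc)]
  refine Finset.prod_congr rfl fun i _ => ?_
  rw [content_apply]
  exact (Finset.prod_eq_pow_card fun c hc => by rw [(Finset.mem_filter.1 hc).2]).symm

theorem map_schurPolynomial {R A : Type*} [CommRing R] [CommRing A] [Algebra R A] {n : ℕ}
    (f : MvPolynomial (Fin n) R →ₐ[R] A) (x : ℕ → A) (hx : ∀ i, f (MvPolynomial.X i) = x i)
    (μ : YoungDiagram) : f (schurPolynomial R μ n) = schurEval x n μ := by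
  rw [schurPolynomial, schurEval, map_sum]
  refine Finset.sum_congr rfl fun T _ => ?_
  rw [map_prod, ← T.1.prod_pow_content x T.2, Finset.prod_range]
  exact Finset.prod_congr rfl fun i _ => by rw [map_pow, hx]

theorem schurEval_mul_schurEval_eq_zero {A : Type*} [CommRing A] (x y : ℕ → A) {n m : ℕ}
    {μ : YoungDiagram} (h : μ ∉ box (n + 1) (m + 1)) :
    schurEval x n μ * schurEval y m μ.transpose = 0 := by
  rw [mem_box_iff_rowLen, not_and_or] at h
  rcases h with h | h
  · have := μ.rowLen_anti n (n + 1) (by omega)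
    rw [schurEval_eq_zero x (by omega), zero_mul]
  · rw [schurEval_transpose_eq_zero y (by omega), mul_zero]

/-- The dual Cauchy identity for Schur polynomials. -/
theorem finsum_schurPolynomial_mul (R : Type*) [CommRing R] (n m : ℕ) :
    (Function.support fun μ : YoungDiagram =>
      MvPolynomial.rename (Sum.inl : Fin n → Fin n ⊕ Fin m) (schurPolynomial R μ n) *
        MvPolynomial.rename (Sum.inr : Fin m → Fin n ⊕ Fin m)
          (schurPolynomial R μ.transpose m)).Finite ∧
    (∑ᶠ μ : YoungDiagram,
      MvPolynomial.rename (Sum.inl : Fin n → Fin n ⊕ Fin m) (schurPolynomial R μ n) *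
        MvPolynomial.rename (Sum.inr : Fin m → Fin n ⊕ Fin m)
          (schurPolynomial R μ.transpose m)) =
      ∏ i : Fin n, ∏ j : Fin m,
        (1 + MvPolynomial.X (Sum.inl i) * MvPolynomial.X (Sum.inr j) :
          MvPolynomial (Fin n ⊕ Fin m) R) := by
  -- Zero is a filler: only the values below `n` (and below `m` for `y`) enter the evaluations.
  let x : ℕ → MvPolynomial (Fin n ⊕ Fin m) R := fun i =>
    if h : i < n then MvPolynomial.X (Sum.inl ⟨i, h⟩) else 0
  let y : ℕ → MvPolynomial (Fin n ⊕ Fin m) R := fun j =>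
    if h : j < m then MvPolynomial.X (Sum.inr ⟨j, h⟩) else 0
  have hx : ∀ i : Fin n, x i = MvPolynomial.X (Sum.inl i) := fun i => by simp [x]
  have hy : ∀ j : Fin m, y j = MvPolynomial.X (Sum.inr j) := fun j => by simp [y]
  have hl := fun μ => map_schurPolynomial (MvPolynomial.rename (R := R) Sum.inl) x
    (fun i => by rw [hx, MvPolynomial.rename_X]) μ
  have hr := fun μ => map_schurPolynomial (MvPolynomial.rename (R := R) Sum.inr) y
    (fun j => by rw [hy, MvPolynomial.rename_X]) μ
  simp only [hl, hr]
  have hsupp : (Function.support fun μ => schurEval x n μ * schurEval y m μ.transpose) ⊆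
      box (n + 1) (m + 1) := fun μ hμ => by
    by_contra h
    exact hμ (schurEval_mul_schurEval_eq_zero x y h)
  refine ⟨(Finset.finite_toSet _).subset hsupp, ?_⟩
  rw [finsum_eq_sum_of_support_subset _ hsupp, sum_schurEval_mul_schurEval x y le_rfl le_rfl,
    Finset.prod_range]
  refine Finset.prod_congr rfl fun i _ => ?_
  rw [Finset.prod_range]
  exact Finset.prod_congr rfl fun j _ => by rw [hx, hy]

/-! ### Infinitely many variables, coefficient by coefficient -/

section PowerSeries

variable {R : Type*} [CommRing R]

theorem SemistandardYoungTableau.lt_of_content {μ : YoungDiagram} {T : SemistandardYoungTableau μ}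
    {n : ℕ} (h : ∀ i, n ≤ i → T.content i = 0) : ∀ c ∈ μ.cells, T c.1 c.2 < n := by
  intro c hc
  by_contra! hn
  have h1 := h _ hn
  rw [content_apply, Finset.card_eq_zero] at h1
  exact Finset.notMem_empty c (h1 ▸ Finset.mem_filter.2 ⟨hc, rfl⟩)

theorem prod_X_eq_monomial_content {τ : Type*} (e : ℕ ↪ τ) {μ : YoungDiagram}
    (T : SemistandardYoungTableau μ) :
    ∏ c ∈ μ.cells, (MvPowerSeries.X (e (T c.1 c.2)) : MvPowerSeries τ R) =
      MvPowerSeries.monomial (Finsupp.embDomain e T.content) 1 := by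
  simp only [MvPowerSeries.X]
  rw [MvPowerSeries.prod_monomial, Finset.prod_const_one, Finsupp.embDomain_eq_mapDomain, content,
    Finsupp.mapDomain_finsetSum]
  simp only [Finsupp.mapDomain_single]

/-- The coefficients of a Schur function at monomials in the first `n` variables only depend on
these variables. -/
theorem coeff_rename_schurFunction {τ : Type*} (e : ℕ ↪ τ) (μ : YoungDiagram) {n : ℕ} {k : τ →₀ ℕ}
    (hk : ∀ i, n ≤ i → k (e i) = 0) :
    MvPowerSeries.coeff k (MvPowerSeries.rename e (schurFunction R μ)) =
      MvPowerSeries.coeff k (schurEval (fun i => MvPowerSeries.X (e i)) n μ) := by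
  classical
  rw [schurEval, map_sum]
  simp only [prod_X_eq_monomial_content, MvPowerSeries.coeff_monomial]
  by_cases h : k ∈ Set.range (Finsupp.mapDomain e)
  · obtain ⟨d, rfl⟩ := h
    rw [← Finsupp.embDomain_eq_mapDomain] at hk ⊢
    simp only [Finsupp.embDomain_apply_self] at hk
    rw [MvPowerSeries.coeff_embDomain_rename, Finset.sum_boole, ← Fintype.card_subtype,
      ← Nat.card_eq_fintype_card]
    -- A content vanishing from `n` on forces all entries below `n`, so both sides count the same
    -- tableaux.
    refine congrArg (Nat.cast : ℕ → R) (Nat.card_congr ?_)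
    exact
      { toFun := fun T => ⟨⟨T.1, lt_of_content fun i hi => by rw [T.2]; exact hk i hi⟩, by rw [T.2]⟩
        invFun := fun T => ⟨T.1.1, (Finsupp.embDomain_injective e T.2).symm⟩
        left_inv := fun T => rfl
        right_inv := fun T => rfl }
  · rw [MvPowerSeries.coeff_rename_eq_zero _ _ h]
    refine (Finset.sum_eq_zero fun T _ => if_neg fun hT => h ⟨T.1.content, ?_⟩).symm
    rw [hT, Finsupp.embDomain_eq_mapDomain]

theorem MvPowerSeries.coeff_mul_congr {σ : Type*} {f f' g g' : MvPowerSeries σ R} {k : σ →₀ ℕ}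
    (hf : ∀ l ≤ k, coeff l f = coeff l f') (hg : ∀ l ≤ k, coeff l g = coeff l g') :
    coeff k (f * g) = coeff k (f' * g') := by
  classical
  rw [coeff_mul, coeff_mul]
  refine Finset.sum_congr rfl fun p hp => ?_
  rw [Finset.HasAntidiagonal.mem_antidiagonal] at hp
  rw [hf _ (hp ▸ le_self_add), hg _ (hp ▸ le_add_self)]

/-- Expanding the product, every term other than `φ` is divisible by a variable absent from the
monomial `k`. -/
theorem MvPowerSeries.coeff_mul_prod_one_add {σ ι : Type*} {k : σ →₀ ℕ} (φ : MvPowerSeries σ R)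
    (s : Finset ι) (g : ι → MvPowerSeries σ R) (hg : ∀ i ∈ s, ∃ a, k a = 0 ∧ X a ∣ g i) :
    coeff k (φ * ∏ i ∈ s, (1 + g i)) = coeff k φ := by
  classical
  induction s using Finset.induction_on with
  | empty => rw [Finset.prod_empty, mul_one]
  | insert i s hi ih =>
    obtain ⟨a, ha, hdvd⟩ := hg i (Finset.mem_insert_self i s)
    rw [Finset.prod_insert hi, add_mul, one_mul, mul_add, map_add,
      ih fun j hj => hg j (Finset.mem_insert_of_mem hj),
      X_dvd_iff.1 ((hdvd.mul_right _).mul_left φ) k ha, add_zero]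

/-- A bound for the indices of the variables that occur in a monomial. -/
def indexBound (k : ℕ ⊕ ℕ →₀ ℕ) : ℕ :=
  k.support.sup (Sum.elim id id) + 1

theorem apply_inl_eq_zero {k : ℕ ⊕ ℕ →₀ ℕ} {i : ℕ} (h : indexBound k ≤ i) : k (Sum.inl i) = 0 := by
  by_contra h0
  have := Finset.le_sup (f := Sum.elim id id) (Finsupp.mem_support_iff.2 h0)
  simp only [Sum.elim_inl, id] at this
  unfold indexBound at h
  omega

theorem apply_inr_eq_zero {k : ℕ ⊕ ℕ →₀ ℕ} {i : ℕ} (h : indexBound k ≤ i) : k (Sum.inr i) = 0 := by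
  by_contra h0
  have := Finset.le_sup (f := Sum.elim id id) (Finsupp.mem_support_iff.2 h0)
  simp only [Sum.elim_inr, id] at this
  unfold indexBound at h
  omega

variable (R) in
/-- The infinite product of the `1 + x i * y j`, given by its coefficients. -/
noncomputable def dualCauchyProduct : MvPowerSeries (ℕ ⊕ ℕ) R := fun k =>
  MvPowerSeries.coeff k (∏ i ∈ Finset.range (indexBound k), ∏ j ∈ Finset.range (indexBound k),
    (1 + MvPowerSeries.X (Sum.inl i) * MvPowerSeries.X (Sum.inr j)))

theorem coeff_dualCauchyProduct (k : ℕ ⊕ ℕ →₀ ℕ) :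
    MvPowerSeries.coeff k (dualCauchyProduct R) = MvPowerSeries.coeff k
      (∏ i ∈ Finset.range (indexBound k), ∏ j ∈ Finset.range (indexBound k),
        (1 + MvPowerSeries.X (Sum.inl i) * MvPowerSeries.X (Sum.inr j))) := rfl

variable [TopologicalSpace R]

theorem hasProd_dualCauchyProduct : HasProd (fun p : ℕ × ℕ =>
    (1 + MvPowerSeries.X (Sum.inl p.1) * MvPowerSeries.X (Sum.inr p.2) :
      MvPowerSeries (ℕ ⊕ ℕ) R)) (dualCauchyProduct R) := by
  rw [HasProd, SummationFilter.unconditional_filter,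
    MvPowerSeries.WithPiTopology.tendsto_iff_coeff_tendsto]
  intro k
  refine tendsto_const_nhds.congr' ?_
  -- The coefficient is constant once the index set contains this square: each further factor
  -- involves a variable absent from `k`.
  filter_upwards [Filter.eventually_ge_atTop
    (Finset.range (indexBound k) ×ˢ Finset.range (indexBound k))] with s hs
  rw [coeff_dualCauchyProduct, ← Finset.prod_product', ← Finset.prod_sdiff hs, mul_comm,
    MvPowerSeries.coeff_mul_prod_one_add]
  rintro ⟨i, j⟩ hp
  simp only [Finset.mem_sdiff, Finset.mem_product, Finset.mem_range, not_and_or, not_lt] at hp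
  rcases hp.2 with h | h
  · exact ⟨Sum.inl i, apply_inl_eq_zero h, dvd_mul_right _ _⟩
  · exact ⟨Sum.inr j, apply_inr_eq_zero h, dvd_mul_left _ _⟩

theorem hasSum_schurFunction_mul : HasSum (fun μ : YoungDiagram =>
    MvPowerSeries.rename (Function.Embedding.inl : ℕ ↪ ℕ ⊕ ℕ) (schurFunction R μ) *
      MvPowerSeries.rename (Function.Embedding.inr : ℕ ↪ ℕ ⊕ ℕ)
        (schurFunction R μ.transpose)) (dualCauchyProduct R) := by
  rw [MvPowerSeries.WithPiTopology.hasSum_iff_hasSum_coeff]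
  intro k
  have hterm : ∀ μ : YoungDiagram, MvPowerSeries.coeff k
      (MvPowerSeries.rename (Function.Embedding.inl : ℕ ↪ ℕ ⊕ ℕ) (schurFunction R μ) *
        MvPowerSeries.rename (Function.Embedding.inr : ℕ ↪ ℕ ⊕ ℕ)
          (schurFunction R μ.transpose)) = MvPowerSeries.coeff k
      (schurEval (fun i => MvPowerSeries.X (Sum.inl i)) (indexBound k) μ *
        schurEval (fun j => MvPowerSeries.X (Sum.inr j)) (indexBound k) μ.transpose) := by
    intro μ
    refine MvPowerSeries.coeff_mul_congr (fun l hl => ?_) fun l hl => ?_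
    · exact coeff_rename_schurFunction Function.Embedding.inl μ fun i hi =>
        Nat.le_zero.1 ((hl _).trans (apply_inl_eq_zero hi).le)
    · exact coeff_rename_schurFunction Function.Embedding.inr μ.transpose fun i hi =>
        Nat.le_zero.1 ((hl _).trans (apply_inr_eq_zero hi).le)
  simp only [hterm]
  -- At a fixed `k` this is the finite identity in `indexBound k` variables of each kind, and only
  -- diagrams in a box contribute.
  rw [coeff_dualCauchyProduct, ← sum_schurEval_mul_schurEval _ _ le_rfl le_rfl, map_sum]
  exact hasSum_sum_of_ne_finset_zero fun μ hμ => by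
    rw [schurEval_mul_schurEval_eq_zero _ _ hμ, map_zero]

end PowerSeries

/-- The variables are `x i = X (Sum.inl i)` and `y j = X (Sum.inr j)`. The first three conjuncts are
the identity in infinitely many variables, for formal power series with the topology of
coefficientwise convergence (the coefficient ring being discrete); the last one is the identity in
finitely many variables, for polynomials. -/
theorem mainTheorem7 (R : Type*) [CommRing R] [TopologicalSpace R] [DiscreteTopology R] :
    (Summable fun μ : YoungDiagram =>
        MvPowerSeries.rename (Function.Embedding.inl : ℕ ↪ ℕ ⊕ ℕ) (schurFunction R μ) *
          MvPowerSeries.rename (Function.Embedding.inr : ℕ ↪ ℕ ⊕ ℕ)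
            (schurFunction R μ.transpose)) ∧
    (Multipliable fun p : ℕ × ℕ =>
        (1 + MvPowerSeries.X (Sum.inl p.1) * MvPowerSeries.X (Sum.inr p.2) :
          MvPowerSeries (ℕ ⊕ ℕ) R)) ∧
    (∑' μ : YoungDiagram,
        MvPowerSeries.rename (Function.Embedding.inl : ℕ ↪ ℕ ⊕ ℕ) (schurFunction R μ) *
          MvPowerSeries.rename (Function.Embedding.inr : ℕ ↪ ℕ ⊕ ℕ)
            (schurFunction R μ.transpose)) =
      (∏' p : ℕ × ℕ,
        (1 + MvPowerSeries.X (Sum.inl p.1) * MvPowerSeries.X (Sum.inr p.2) :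
          MvPowerSeries (ℕ ⊕ ℕ) R)) ∧
    (∀ n m : ℕ,
      (Function.support fun μ : YoungDiagram =>
        MvPolynomial.rename (Sum.inl : Fin n → Fin n ⊕ Fin m) (schurPolynomial R μ n) *
          MvPolynomial.rename (Sum.inr : Fin m → Fin n ⊕ Fin m)
            (schurPolynomial R μ.transpose m)).Finite ∧
      (∑ᶠ μ : YoungDiagram,
        MvPolynomial.rename (Sum.inl : Fin n → Fin n ⊕ Fin m) (schurPolynomial R μ n) *
          MvPolynomial.rename (Sum.inr : Fin m → Fin n ⊕ Fin m)
            (schurPolynomial R μ.transpose m)) =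
        ∏ i : Fin n, ∏ j : Fin m,
          (1 + MvPolynomial.X (Sum.inl i) * MvPolynomial.X (Sum.inr j) :
            MvPolynomial (Fin n ⊕ Fin m) R)) :=
  ⟨hasSum_schurFunction_mul.summable, hasProd_dualCauchyProduct.multipliable,
    hasSum_schurFunction_mul.tsum_eq.trans hasProd_dualCauchyProduct.tprod_eq.symm,
    finsum_schurPolynomial_mul R⟩
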